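/- **Notation.** Let $N\geq 2$. The space $\mathbb{R}^{N\times N}$ carries its Euclidean norm $\|\cdot\|$. The discrete gradient $\nabla\colon\mathbb{R}^{N\times N}\to\mathbb{R}^{N\times N}\oplus\mathbb{R}^{N\times N}$ maps $(\xi_{k,l})_{1\leq k,l\leq N}$ to $(\eta^{(1)}_{k,l},\eta^{(2)}_{k,l})_{1\leq k,l\leq N}$, where $\eta^{(1)}_{k,l}=\xi_{k+1,l}-\xi_{k,l}$ if $k<N$, $\eta^{(1)}_{N,l}=0$, $\eta^{(2)}_{k,l}=\xi_{k,l+1}-\xi_{k,l}$ if $l<N$, and $\eta^{(2)}_{k,N}=0$. The discrete divergence $\operatorname{div}\colon\mathbb{R}^{N\times N}\oplus\mathbb{R}^{N\times N}\to\mathbb{R}^{N\times N}$ maps $(\eta^{(1)}_{k,l},\eta^{(2)}_{k,l})_{1\leq k,l\leq N}$ to $(\xi^{(1)}_{k,l}+\xi^{(2)}_{k,l})_{1\leq k,l\leq N}$, where $\xi^{(1)}_{k,l}$ equals $\eta^{(1)}_{1,l}$ if $k=1$, $\eta^{(1)}_{k,l}-\eta^{(1)}_{k-1,l}$ if $1<k<N$,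 and $-\eta^{(1)}_{N-1,l}$ if $k=N$; and $\xi^{(2)}_{k,l}$ equals $\eta^{(2)}_{k,1}$ if $l=1$, $\eta^{(2)}_{k,l}-\eta^{(2)}_{k,l-1}$ if $1<l<N$, and $-\eta^{(2)}_{k,N-1}$ if $l=N$. Let $p\in[1,+\infty]$ and let $p^*$ be its conjugate index ($1/p+1/p^*=1$). For $q\in[1,+\infty]$ let $|\cdot|_q$ be the $\ell^q$ norm on $\mathbb{R}^2$. Set $\operatorname{tv}_p(x)=\sum_{1\leq k,l\leq N}|(\eta^{(1)}_{k,l},\eta^{(2)}_{k,l})|_p$, where $(\eta^{(1)}_{k,l},\eta^{(2)}_{k,l})_{1\leq k,l\leq N}=\nabla x$, and $$D_p=\Big\{(\nu^{(1)}_{k,l},\nu^{(2)}_{k,l})_{1\leq k,l\leq N}\in\mathbb{R}^{N\times N}\oplus\mathbb{R}^{N\times N}\;:\;\max_{1\leq k,l\leq N}|(\nu^{(1)}_{k,l},\nu^{(2)}_{k,l})|_{p^*}\leq 1\Big\}.$$ For $\mathsf{y}\in\mathbb{R}^2$, let $(\pi^{(1)}_p\mathsf{y},\pi^{(2)}_p\mathsf{y})$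 be the projection of $\mathsf{y}$, for the Euclidean distance, onto the closed unit ball of $|\cdot|_{p^*}$. Let $z\in\mathbb{R}^{N\times N}$, let $\mu\in\,]0,+\infty[$, and let $f\colon\mathbb{R}^{N\times N}\to\,]-\infty,+\infty]$ be convex, lower semicontinuous and proper (not identically $+\infty$). Denote by $\operatorname{prox}_f y$ the unique minimizer of $w\mapsto f(w)+\frac12\|y-w\|^2$, by $f^*(u)=\sup_{w}\langle w,u\rangle-f(w)$ the conjugate of $f$, and by $\widetilde{f^*}(y)=\inf_{w}f^*(w)+\frac12\|y-w\|^2$ the Moreau envelope of $f^*$. The primal problem is $$\underset{x\in\mathbb{R}^{N\times N}}{\mathrm{minimize}}\;\; f(x)+\mu\operatorname{tv}_p(x)+\tfrac12\|x-z\|^2,\qquad(\mathrm{P})$$ and the dual problem is $$\underset{v\in D_p}{\mathrm{minimize}}\;\;\widetilde{f^*}(z+\mu\operatorname{div}v).\qquad(\mathrm{D})$$ **Proposition.** Let $(\alpha^{(1)}_{n,k,l})_{1\leq k,l\leq N}$ and $(\alpha^{(2)}_{n,k,l})_{1\leq k,l\leq N}$, $n\in\mathbb{N}$, be sequences in $\mathbb{R}^{N\times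 N}$ such that $$\sum_{n\in\mathbb{N}}\sqrt{\sum_{1\leq k,l\leq N}\big(|\alpha^{(1)}_{n,k,l}|^2+|\alpha^{(2)}_{n,k,l}|^2\big)}<+\infty,$$ and let $(b_n)_{n\in\mathbb{N}}$ be a sequence in $\mathbb{R}^{N\times N}$ such that $\sum_{n\in\mathbb{N}}\|b_n\|<+\infty$. Let $\varepsilon\in\,]0,\min\{1,\mu^{-1}/8\}[$, let $\tau_n\in[\varepsilon,\mu^{-1}/4-\varepsilon]$ and $\lambda_n\in[\varepsilon,1]$ for every $n\in\mathbb{N}$, let $v_0\in\mathbb{R}^{N\times N}\oplus\mathbb{R}^{N\times N}$ be arbitrary, and let $(x_n)_{n\in\mathbb{N}}$ and $(v_n)_{n\in\mathbb{N}}=\big((\nu^{(1)}_{n,k,l},\nu^{(2)}_{n,k,l})_{1\leq k,l\leq N}\big)_{n\in\mathbb{N}}$ be generated, for $n=0,1,\ldots$, by $$x_n=\operatorname{prox}_f(z+\mu\operatorname{div}v_n)+b_n,\qquad (\zeta^{(1)}_{n,k,l},\zeta^{(2)}_{n,k,l})_{1\leq k,l\leq N}=v_n+\tau_n\nabla x_n,$$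 $$\nu^{(i)}_{n+1,k,l}=\nu^{(i)}_{n,k,l}+\lambda_n\Big(\pi^{(i)}_p\big(\zeta^{(1)}_{n,k,l},\zeta^{(2)}_{n,k,l}\big)+\alpha^{(i)}_{n,k,l}-\nu^{(i)}_{n,k,l}\Big),\qquad i\in\{1,2\},\;1\leq k,l\leq N.$$ Then $(v_n)_{n\in\mathbb{N}}$ converges to a solution $v$ to (D), $x=\operatorname{prox}_f(z+\mu\operatorname{div}v)$ is the unique solution to (P), and $x_n\to x$. -/

import Mathlib

open Filter Topology
open scoped ENNReal

namespace TVDenoising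

noncomputable section

section ConvexAnalysis

variable {E : Type*} [NormedAddCommGroup E] [InnerProductSpace ℝ E]

/-- The class `Γ₀(E)`: lower semicontinuous convex functions `E → ]-∞, +∞]` which are proper,
that is, whose domain `{x | f x < +∞}` is nonempty. -/
structure IsGammaZero (f : E → EReal) : Prop where
  ne_bot : ∀ x, f x ≠ ⊥
  proper : ∃ x, f x < ⊤
  convex : ∀ x y : E, ∀ a b : ℝ, 0 < a → 0 < b → a + b = 1 →
    f (a • x + b • y) ≤ (a : EReal) * f x + (b : EReal) * f y
  lsc : LowerSemicontinuous f

/-- `x` solves the problem of minimizing `φ` over `C`; as usual for extended-valued objectives,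
`x` has to lie in the domain of `φ`. -/
def IsSolution (C : Set E) (φ : E → EReal) (x : E) : Prop :=
  x ∈ C ∧ φ x < ⊤ ∧ ∀ y ∈ C, φ x ≤ φ y

/-- The Fenchel conjugate `f*(u) = sup_x ⟨x, u⟩ - f x`. -/
def conjugate (f : E → EReal) (u : E) : EReal :=
  ⨆ x : E, ((inner ℝ x u : ℝ) : EReal) - f x

/-- The Moreau envelope `x ↦ inf_y f y + ‖x - y‖² / 2`. -/
def moreauEnvelope (f : E → EReal) (x : E) : EReal :=
  ⨅ y : E, f y + ((1 / 2 * ‖x - y‖ ^ 2 : ℝ) : EReal)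

/-- The proximity operator: `prox f x` is the minimizer of `y ↦ f y + ‖x - y‖² / 2`
(which exists and is unique when `f ∈ Γ₀(E)` and `E` is complete). -/
def prox (f : E → EReal) (x : E) : E :=
  Classical.epsilon fun q : E =>
    IsSolution Set.univ (fun y : E => f y + ((1 / 2 * ‖x - y‖ ^ 2 : ℝ) : EReal)) q

/-- The projection onto `C`: the point `q` of `C` such that `‖x - q‖ = d_C(x)`
(which exists and is unique when `C` is nonempty, closed and convex and `E` is complete). -/
def proj (C : Set E) (x : E) : E :=
  Classical.epsilon fun q : E => q ∈ C ∧ ‖x - q‖ = Metric.infDist x C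

end ConvexAnalysis

/-- The Euclidean space `ℝ^{N×N}`. The indices `1, …, N` are `0, …, N - 1` here. -/
abbrev Img (N : ℕ) : Type := EuclideanSpace ℝ (Fin N × Fin N)

/-- The Hilbert direct sum `ℝ^{N×N} ⊕ ℝ^{N×N}`. -/
abbrev Fld (N : ℕ) : Type := WithLp 2 (Img N × Img N)

/-- The discrete gradient: forward differences, and `0` at the last index. -/
def grad {N : ℕ} (x : Img N) : Fld N :=
  WithLp.toLp 2
    (WithLp.toLp 2 (fun kl : Fin N × Fin N =>
      if h : kl.1.val + 1 < N then x (⟨kl.1.val + 1, h⟩, kl.2) - x kl else 0),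
     WithLp.toLp 2 (fun kl : Fin N × Fin N =>
      if h : kl.2.val + 1 < N then x (kl.1, ⟨kl.2.val + 1, h⟩) - x kl else 0))

/-- The index before `k` (only used when `k` is not the first index). -/
def prevIdx {N : ℕ} (k : Fin N) : Fin N := ⟨k.val - 1, lt_of_le_of_lt (Nat.sub_le _ _) k.isLt⟩

/-- The discrete divergence (for `N ≥ 2`, so that the first and the last index differ). -/
def dvg {N : ℕ} (y : Fld N) : Img N :=
  WithLp.toLp 2 (fun kl : Fin N × Fin N =>
    (if kl.1.val = 0 then y.fst kl
      else if kl.1.val + 1 < N then y.fst kl - y.fst (prevIdx kl.1, kl.2)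
      else - y.fst (prevIdx kl.1, kl.2)) +
    (if kl.2.val = 0 then y.snd kl
      else if kl.2.val + 1 < N then y.snd kl - y.snd (kl.1, prevIdx kl.2)
      else - y.snd (kl.1, prevIdx kl.2)))

/-- The `ℓ^q` norm of the pair `(s, t)`, for `q ∈ [1, +∞]`. -/
def pairNorm (q : ℝ≥0∞) (s t : ℝ) : ℝ :=
  if q = ⊤ then max |s| |t| else (|s| ^ q.toReal + |t| ^ q.toReal) ^ (1 / q.toReal)

/-- The norm `‖y‖_{p,1}`: the sum over all pixels of the `ℓ^p` norms of the pairs. -/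
def normPOne {N : ℕ} (p : ℝ≥0∞) (y : Fld N) : ℝ :=
  ∑ k : Fin N, ∑ l : Fin N, pairNorm p (y.fst (k, l)) (y.snd (k, l))

/-- The `p`-th order discrete total variation. -/
def tv {N : ℕ} (p : ℝ≥0∞) (x : Img N) : ℝ := normPOne p (grad x)

/-- The dual constraint set `D_p`; here `p.conjExponent` is the conjugate index `p*`. -/
def dualSet (N : ℕ) (p : ℝ≥0∞) : Set (Fld N) :=
  {v | ∀ k l : Fin N, pairNorm p.conjExponent (v.fst (k, l)) (v.snd (k, l)) ≤ 1}

/-- The closed unit `ℓ^q` ball, as a subset of the Euclidean plane. -/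
def lpBall (q : ℝ≥0∞) : Set (EuclideanSpace ℝ (Fin 2)) := {y | pairNorm q (y 0) (y 1) ≤ 1}

/-- The projection of the point `(s, t)` of the Euclidean plane onto the closed unit
`ℓ^{p*}` ball. -/
def pairProj (p : ℝ≥0∞) (s t : ℝ) : EuclideanSpace ℝ (Fin 2) :=
  proj (lpBall p.conjExponent) !₂[s, t]

/-- The primal objective `f x + μ tv_p(x) + ‖x - z‖² / 2`. -/
def primalObj {N : ℕ} (f : Img N → EReal) (μ : ℝ) (p : ℝ≥0∞) (z x : Img N) : EReal :=
  f x + ((μ * tv p x + 1 / 2 * ‖x - z‖ ^ 2 : ℝ) : EReal)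

/-- The dual objective: the Moreau envelope of the conjugate of `f`, at `z + μ div v`. -/
def dualObj {N : ℕ} (f : Img N → EReal) (μ : ℝ) (z : Img N) (v : Fld N) : EReal :=
  moreauEnvelope (conjugate f) (z + μ • dvg v)

end

end TVDenoising

open TVDenoising

/-!
Write `x(v) = prox f (z + μ div v)`. The Moreau envelope of `f*` is a real convex function `φ` with
`φ(w') ≥ φ(w) + ⟨prox f w, w' - w⟩` (`moreauEnvelope_conjugate`, `conjEnvelope_add_inner_le`), so
that, since `div = -∇*` (`inner_grad`), the solutions of the dual problem are characterized by the
variational inequality: `v ∈ D_p` and `⟨∇ x(v), d - v⟩ ≤ 0` for all `d ∈ D_p`. A solution exists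
because `D_p` is compact (`dualVI_nonempty`).

The iteration is a relaxed forward-backward method for this inequality. Firm nonexpansiveness of
`prox f` and `‖∇‖² ≤ 8` make `v ↦ -∇ x(v)` cocoercive with constant `μ⁻¹ / 8`, so a step of size
`τ < μ⁻¹ / 4` followed by the projection onto `D_p` decreases the squared distance to every solution
`u`, with a gain controlling `‖x(v) - x(u)‖` and the length of the step (`forwardBackward_step`).
With summable errors the distances to the solutions still converge, the gains tend to zero, every
cluster point of `v` solves the variational inequality, and therefore the whole sequence converges
to one solution (`forwardBackward_tendsto`). Continuity of `prox f` gives the limit of `x`.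

Hölder's inequality and its equality case express `tv_p(x)` as the maximum of `⟨∇ x, d⟩` over
`d ∈ D_p`. At a solution `u` the maximum for `x(u)` is attained at `u`; combined with the
subgradient inequality for `prox f` this shows that the primal objective at `y` exceeds its value at `x(u)` by
at least `‖y - x(u)‖² / 2` (`primalObj_add_le`), whence optimality and uniqueness.
-/

namespace TVDenoising

/-! ### Proximity operator and Moreau envelope of the conjugate -/

section ConvexAnalysis

variable {E : Type*} [NormedAddCommGroup E] [InnerProductSpace ℝ E]

theorem IsGammaZero.exists_real_value {f : E → EReal} (hf : IsGammaZero f) {x : E}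
    (hx : f x < ⊤) : ∃ r : ℝ, f x = r :=
  ⟨(f x).toReal, (EReal.coe_toReal hx.ne (hf.ne_bot x)).symm⟩

/-- In finite dimension a function in `Γ₀` decreases at most linearly: it is bounded below on a
closed unit ball centred in its domain, and convexity along rays from the centre spreads the
bound. -/
theorem IsGammaZero.exists_linear_lower_bound [FiniteDimensional ℝ E] {f : E → EReal}
    (hf : IsGammaZero f) {x₀ : E} {r₀ : ℝ} (hx₀ : f x₀ = r₀) :
    ∃ c : ℝ, 0 ≤ c ∧ ∀ y, ((r₀ - c - c * ‖y - x₀‖ : ℝ) : EReal) ≤ f y := by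
  obtain ⟨a, ha, hmin⟩ := (hf.lsc.lowerSemicontinuousOn _).exists_isMinOn
    (s := Metric.closedBall x₀ 1) ⟨x₀, by simp⟩ (isCompact_closedBall x₀ 1)
  have ha₀ : f a ≤ r₀ := hx₀ ▸ hmin (show x₀ ∈ Metric.closedBall x₀ 1 by simp)
  obtain ⟨m, hm⟩ := hf.exists_real_value (ha₀.trans_lt (EReal.coe_lt_top r₀))
  have hmr : m ≤ r₀ := by rw [hm] at ha₀; exact_mod_cast ha₀
  refine ⟨r₀ - m, by linarith, fun y => ?_⟩
  by_cases hy : f y < ⊤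
  swap
  · rw [not_lt_top_iff.1 hy]; exact le_top
  obtain ⟨s, hs⟩ := hf.exists_real_value hy
  rw [hs, EReal.coe_le_coe_iff]
  rcases le_or_gt ‖y - x₀‖ 1 with h1 | h1
  · have hms : m ≤ s := by
      have h : f a ≤ f y := hmin (show y ∈ Metric.closedBall x₀ 1 by
        rwa [Metric.mem_closedBall, dist_eq_norm])
      rw [hm, hs] at h
      exact_mod_cast h
    nlinarith [norm_nonneg (y - x₀)]
  · set ρ := ‖y - x₀‖ with hρ
    have hρ0 : 0 < ρ := by linarith
    have hinv : 0 < ρ⁻¹ := inv_pos.2 hρ0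
    have hinv1 : ρ⁻¹ < 1 := inv_lt_one_of_one_lt₀ h1
    have hmem : (1 - ρ⁻¹) • x₀ + ρ⁻¹ • y ∈ Metric.closedBall x₀ 1 := by
      rw [Metric.mem_closedBall, dist_eq_norm,
        show (1 - ρ⁻¹) • x₀ + ρ⁻¹ • y - x₀ = ρ⁻¹ • (y - x₀) by module, norm_smul, ← hρ,
        Real.norm_of_nonneg hinv.le, inv_mul_cancel₀ hρ0.ne']
    have h2 : f a ≤ _ := hmin hmem
    have h3 := h2.trans (hf.convex x₀ y (1 - ρ⁻¹) ρ⁻¹ (by linarith) hinv (by ring))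
    rw [hm, hx₀, hs] at h3
    have h4 : m ≤ (1 - ρ⁻¹) * r₀ + ρ⁻¹ * s := by exact_mod_cast h3
    have h5 : ρ * m ≤ (ρ - 1) * r₀ + s := by
      calc ρ * m ≤ ρ * ((1 - ρ⁻¹) * r₀ + ρ⁻¹ * s) := by gcongr
        _ = (ρ - 1) * r₀ + s := by field_simp
    nlinarith

/-- The linear lower bound makes `y ↦ f y + ‖w - y‖² / 2` coercive, so it suffices to minimize it
over a large ball around a point of the domain of `f`. -/
theorem exists_isSolution_prox [FiniteDimensional ℝ E] {f : E → EReal} (hf : IsGammaZero f)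
    (w : E) : ∃ q, IsSolution Set.univ
      (fun y : E => f y + ((1 / 2 * ‖w - y‖ ^ 2 : ℝ) : EReal)) q := by
  obtain ⟨x₀, hx₀⟩ := hf.proper
  obtain ⟨r₀, hr₀⟩ := hf.exists_real_value hx₀
  obtain ⟨c, hc, hlow⟩ := hf.exists_linear_lower_bound hr₀
  set d := ‖w - x₀‖ with hd
  have hd0 : 0 ≤ d := norm_nonneg _
  have hlsc : LowerSemicontinuous
      (fun y : E => f y + ((1 / 2 * ‖w - y‖ ^ 2 : ℝ) : EReal)) := by
    refine hf.lsc.add' (Continuous.lowerSemicontinuous ?_) fun y => ?_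
    · exact continuous_coe_real_ereal.comp (by fun_prop)
    · exact EReal.continuousAt_add (Or.inr (EReal.coe_ne_bot _)) (Or.inr (EReal.coe_ne_top _))
  obtain ⟨q, -, hq⟩ := (hlsc.lowerSemicontinuousOn _).exists_isMinOn
    (s := Metric.closedBall x₀ (2 * (c + d) + 2 * (c + 1)))
    ⟨x₀, by simpa using by positivity⟩ (isCompact_closedBall _ _)
  have hqx : f q + ((1 / 2 * ‖w - q‖ ^ 2 : ℝ) : EReal) ≤
      f x₀ + ((1 / 2 * ‖w - x₀‖ ^ 2 : ℝ) : EReal) :=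
    hq (show x₀ ∈ Metric.closedBall x₀ _ by simpa using by positivity)
  have hx₀' : f x₀ + ((1 / 2 * ‖w - x₀‖ ^ 2 : ℝ) : EReal) =
      ((r₀ + 1 / 2 * d ^ 2 : ℝ) : EReal) := by rw [hr₀]; norm_cast
  refine ⟨q, Set.mem_univ _, ?_, fun y _ => ?_⟩
  · exact (hqx.trans_eq hx₀').trans_lt (EReal.coe_lt_top _)
  · by_cases hy : y ∈ Metric.closedBall x₀ (2 * (c + d) + 2 * (c + 1))
    · exact hq hy
    refine hqx.trans (hx₀'.trans_le ?_)
    rw [Metric.mem_closedBall, dist_eq_norm, not_le] at hy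
    calc ((r₀ + 1 / 2 * d ^ 2 : ℝ) : EReal)
        ≤ ((r₀ - c - c * ‖y - x₀‖ + 1 / 2 * ‖w - y‖ ^ 2 : ℝ) : EReal) := by
          rw [EReal.coe_le_coe_iff]
          have h1 : ‖y - x₀‖ - d ≤ ‖w - y‖ := by
            have := norm_sub_le_norm_sub_add_norm_sub y w x₀
            rw [norm_sub_rev y w] at this
            linarith
          have h2 : (‖y - x₀‖ - d) ^ 2 ≤ ‖w - y‖ ^ 2 := by
            gcongr
            linarith
          nlinarith
      _ = ((r₀ - c - c * ‖y - x₀‖ : ℝ) : EReal) + ((1 / 2 * ‖w - y‖ ^ 2 : ℝ) : EReal) := by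
          norm_cast
      _ ≤ _ := add_le_add (hlow y) le_rfl

/-- The variational characterization of `q = prox f w`: the vector `w - q` is a subgradient of `f`
at `q`. -/
theorem exists_prox_value [FiniteDimensional ℝ E] {f : E → EReal} (hf : IsGammaZero f) (w : E) :
    ∃ r : ℝ, f (prox f w) = r ∧
      ∀ y, ((r + inner ℝ (w - prox f w) (y - prox f w) : ℝ) : EReal) ≤ f y := by
  obtain ⟨-, hfin, hmin⟩ : IsSolution Set.univ
      (fun y : E => f y + ((1 / 2 * ‖w - y‖ ^ 2 : ℝ) : EReal)) (prox f w) :=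
    Classical.epsilon_spec (exists_isSolution_prox hf w)
  set q := prox f w
  have hq : f q < ⊤ := by
    refine lt_top_iff_ne_top.2 fun h => ?_
    simp only [h, EReal.top_add_coe, lt_irrefl] at hfin
  obtain ⟨r, hr⟩ := hf.exists_real_value hq
  refine ⟨r, hr, fun y => ?_⟩
  by_cases hy : f y < ⊤
  swap
  · rw [not_lt_top_iff.1 hy]; exact le_top
  obtain ⟨s, hs⟩ := hf.exists_real_value hy
  rw [hs, EReal.coe_le_coe_iff]
  -- compare the objective at `q` and at `(1 - t) q + t y`, and let `t` be small
  have key : ∀ t : ℝ, 0 < t → t < 1 →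
      inner ℝ (w - q) (y - q) - (s - r) ≤ t / 2 * ‖y - q‖ ^ 2 := by
    intro t ht ht1
    have h1 := hmin ((1 - t) • q + t • y) (Set.mem_univ _)
    have h2 := h1.trans (add_le_add_left
      (hf.convex q y (1 - t) t (by linarith) ht (by ring)) _)
    simp only [hr, hs] at h2
    have h3 : r + 1 / 2 * ‖w - q‖ ^ 2 ≤
        (1 - t) * r + t * s + 1 / 2 * ‖w - ((1 - t) • q + t • y)‖ ^ 2 := by exact_mod_cast h2
    rw [show w - ((1 - t) • q + t • y) = (w - q) - t • (y - q) by module,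
      norm_sub_sq_real (w - q), norm_smul, inner_smul_right, Real.norm_of_nonneg ht.le] at h3
    refine le_of_mul_le_mul_left ?_ ht
    nlinarith
  by_contra! hcon
  set D := inner ℝ (w - q) (y - q) - (s - r)
  have hD : 0 < D := by simp only [D]; linarith
  have hM : 0 ≤ ‖y - q‖ ^ 2 := by positivity
  set M := ‖y - q‖ ^ 2
  have hpos : 0 < D + M + 1 := by linarith
  have h := key (D / (D + M + 1)) (by positivity) ((div_lt_one hpos).2 (by linarith))
  rw [div_div, div_mul_eq_mul_div, le_div_iff₀ (by positivity)] at h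
  nlinarith

/-- The real value of `f` at `prox f w`. -/
noncomputable def proxValue (f : E → EReal) (w : E) : ℝ := (f (prox f w)).toReal

section FiniteDimensional

variable [FiniteDimensional ℝ E] {f : E → EReal}

theorem apply_prox (hf : IsGammaZero f) (w : E) : f (prox f w) = proxValue f w := by
  obtain ⟨r, hr, -⟩ := exists_prox_value hf w
  rw [proxValue, hr, EReal.toReal_coe]

theorem proxValue_add_inner_le (hf : IsGammaZero f) (w y : E) :
    ((proxValue f w + inner ℝ (w - prox f w) (y - prox f w) : ℝ) : EReal) ≤ f y := by
  obtain ⟨r, hr, h⟩ := exists_prox_value hf w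
  rw [proxValue, hr, EReal.toReal_coe]
  exact h y

theorem proxValue_add_inner_le_proxValue (hf : IsGammaZero f) (w w' : E) :
    proxValue f w + inner ℝ (w - prox f w) (prox f w' - prox f w) ≤ proxValue f w' := by
  have h := proxValue_add_inner_le hf w (prox f w')
  rw [apply_prox hf w', EReal.coe_le_coe_iff] at h
  exact h

/-- The proximity operator is firmly nonexpansive. -/
theorem norm_prox_sub_sq_le (hf : IsGammaZero f) (w w' : E) :
    ‖prox f w - prox f w'‖ ^ 2 ≤ inner ℝ (prox f w - prox f w') (w - w') := by
  have h1 := proxValue_add_inner_le_proxValue hf w w'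
  have h2 := proxValue_add_inner_le_proxValue hf w' w
  rw [← real_inner_self_eq_norm_sq]
  simp only [inner_sub_left, inner_sub_right] at *
  linarith [real_inner_comm w (prox f w), real_inner_comm w (prox f w'),
    real_inner_comm w' (prox f w), real_inner_comm w' (prox f w'),
    real_inner_comm (prox f w) (prox f w')]

theorem norm_prox_sub_le (hf : IsGammaZero f) (w w' : E) :
    ‖prox f w - prox f w'‖ ≤ ‖w - w'‖ := by
  have h := (norm_prox_sub_sq_le hf w w').trans (real_inner_le_norm _ _)
  rcases (norm_nonneg (prox f w - prox f w')).eq_or_lt with h0 | h0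
  · rw [← h0]; exact norm_nonneg _
  · exact le_of_mul_le_mul_left (by rwa [← sq]) h0

theorem continuous_prox (hf : IsGammaZero f) : Continuous (prox f) :=
  (LipschitzWith.of_dist_le_mul (K := 1) fun w w' => by
    simpa [dist_eq_norm] using norm_prox_sub_le hf w w').continuous

/-- The Moreau envelope of `f*`, written in terms of `q = prox f w` as
`⟨q, w⟩ - f q - ‖q‖² / 2`; see `moreauEnvelope_conjugate`. -/
noncomputable def conjEnvelope (f : E → EReal) (w : E) : ℝ :=
  inner ℝ (prox f w) w - proxValue f w - 1 / 2 * ‖prox f w‖ ^ 2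

theorem moreauEnvelope_conjugate (hf : IsGammaZero f) (w : E) :
    moreauEnvelope (conjugate f) w = conjEnvelope f w := by
  set q := prox f w with hq
  apply le_antisymm
  · -- the infimum is attained at `w - q`
    refine (iInf_le _ (w - q)).trans ?_
    have h : conjugate f (w - q) ≤ ((inner ℝ q (w - q) - proxValue f w : ℝ) : EReal) := by
      refine iSup_le fun y => ?_
      refine (EReal.sub_le_sub le_rfl (proxValue_add_inner_le hf w y)).trans ?_
      rw [← EReal.coe_sub, EReal.coe_le_coe_iff, ← hq]
      simp only [inner_sub_left, inner_sub_right]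
      rw [real_inner_comm y w, real_inner_comm y q, real_inner_comm q w]
      linarith
    refine (add_le_add_left h _).trans ?_
    rw [← EReal.coe_add, EReal.coe_le_coe_iff, conjEnvelope, ← hq, sub_sub_cancel,
      inner_sub_right, real_inner_self_eq_norm_sq]
    linarith
  · refine le_iInf fun u => ?_
    have h : ((inner ℝ q u - proxValue f w : ℝ) : EReal) ≤ conjugate f u := by
      refine le_trans ?_ (le_iSup _ q)
      rw [apply_prox hf w, EReal.coe_sub]
    refine le_trans ?_ (add_le_add_left h _)
    rw [← EReal.coe_add, EReal.coe_le_coe_iff, conjEnvelope, ← hq]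
    have h1 : 0 ≤ ‖(w - u) - q‖ ^ 2 := by positivity
    rw [norm_sub_sq_real, real_inner_comm, inner_sub_right] at h1
    linarith

/-- `prox f w` is a subgradient (in fact, the gradient) at `w` of the Moreau envelope of `f*`. -/
theorem conjEnvelope_add_inner_le (hf : IsGammaZero f) (w w' : E) :
    conjEnvelope f w + inner ℝ (prox f w) (w' - w) ≤ conjEnvelope f w' := by
  have h := proxValue_add_inner_le_proxValue hf w' w
  have h1 : 0 ≤ ‖prox f w - prox f w'‖ ^ 2 := by positivity
  rw [norm_sub_sq_real] at h1
  simp only [conjEnvelope, inner_sub_left, inner_sub_right, real_inner_self_eq_norm_sq] at *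
  rw [real_inner_comm (prox f w) w', real_inner_comm (prox f w') w',
    real_inner_comm (prox f w) (prox f w')] at h
  linarith

theorem continuous_conjEnvelope (hf : IsGammaZero f) : Continuous (conjEnvelope f) := by
  have hc := continuous_prox hf
  refine continuous_iff_continuousAt.2 fun w => ?_
  refine tendsto_of_tendsto_of_tendsto_of_le_of_le
    (g := fun w' => conjEnvelope f w + inner ℝ (prox f w) (w' - w))
    (h := fun w' => conjEnvelope f w + inner ℝ (prox f w') (w' - w)) ?_ ?_
    (fun w' => conjEnvelope_add_inner_le hf w w') (fun w' => ?_)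
  · have : Continuous fun w' => conjEnvelope f w + inner ℝ (prox f w) (w' - w) := by fun_prop
    simpa using this.tendsto w
  · have : Continuous fun w' => conjEnvelope f w + inner ℝ (prox f w') (w' - w) := by fun_prop
    simpa using this.tendsto w
  · have h := conjEnvelope_add_inner_le hf w' w
    have h2 : inner ℝ (prox f w') (w - w') = - inner ℝ (prox f w') (w' - w) := by
      rw [← inner_neg_right, neg_sub]
    simp only
    linarith

end FiniteDimensional

end ConvexAnalysis

/-! ### Convergence of the forward-backward iteration with summable errors -/

section ForwardBackward

theorem tendsto_of_le_add_summable {a e : ℕ → ℝ} (ha : ∀ n, 0 ≤ a n) (he : Summable e)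
    (h : ∀ n, a (n + 1) ≤ a n + e n) : ∃ l, Tendsto a atTop (𝓝 l) := by
  -- subtracting the partial sums of the errors gives a nonincreasing bounded sequence
  have hanti : Antitone fun n => a n - ∑ i ∈ Finset.range n, e i := by
    refine antitone_nat_of_succ_le fun n => ?_
    rw [Finset.sum_range_succ]
    linarith [h n]
  have hs := he.hasSum.tendsto_sum_nat
  obtain ⟨C, hC⟩ := hs.bddAbove_range
  have hbdd : BddBelow (Set.range fun n => a n - ∑ i ∈ Finset.range n, e i) := by
    refine ⟨-C, ?_⟩
    rintro _ ⟨n, rfl⟩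
    have h1 : ∑ i ∈ Finset.range n, e i ≤ C := hC ⟨n, rfl⟩
    have := ha n
    simp only
    linarith
  refine ⟨_, ((tendsto_atTop_ciInf hanti hbdd).add hs).congr fun n => ?_⟩
  simp

variable {H G : Type*} [NormedAddCommGroup H] [InnerProductSpace ℝ H]
  [NormedAddCommGroup G] [InnerProductSpace ℝ G]

/-- The solutions `u ∈ D` of the variational inequality `⟨w(u), d - u⟩ ≤ 0` for all `d ∈ D`. -/
def viSet (D : Set H) (w : H → H) : Set H :=
  {u | u ∈ D ∧ ∀ d ∈ D, inner ℝ (w u) (d - u) ≤ 0}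

theorem norm_sub_le_of_variational {D : Set H} {P : H → H} (hPD : ∀ y, P y ∈ D)
    (hP : ∀ y, ∀ d ∈ D, inner ℝ (y - P y) (d - P y) ≤ 0) (y y' : H) :
    ‖P y - P y'‖ ≤ ‖y - y'‖ := by
  have h1 := hP y _ (hPD y')
  have h2 := hP y' _ (hPD y)
  have h3 : ‖P y - P y'‖ ^ 2 ≤ inner ℝ (y - y') (P y - P y') := by
    have e : inner ℝ (y - P y) (P y' - P y) + inner ℝ (y' - P y') (P y - P y') =
        ‖P y - P y'‖ ^ 2 - inner ℝ (y - y') (P y - P y') := by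
      rw [← real_inner_self_eq_norm_sq]
      simp only [inner_sub_left, inner_sub_right]
      ring
    linarith
  have h := h3.trans (real_inner_le_norm _ _)
  rcases (norm_nonneg (P y - P y')).eq_or_lt with h0 | h0
  · rw [← h0]; exact norm_nonneg _
  · exact le_of_mul_le_mul_right (by rwa [← sq]) h0

/-- One exact forward-backward step `t` from `v` gets closer to every solution `u` of the
variational inequality, with an explicit gain. -/
theorem forwardBackward_step {D : Set H} {Q : H → G} (K : G →ₗ[ℝ] H) {c m τ : ℝ}
    (hK : ∀ x, ‖K x‖ ^ 2 ≤ c * ‖x‖ ^ 2)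
    (hQ : ∀ v u, m * ‖Q v - Q u‖ ^ 2 ≤ - inner ℝ (K (Q v - Q u)) (v - u))
    (hτ : 0 ≤ τ) {u v t : H} (hu : u ∈ viSet D fun u => K (Q u)) (htD : t ∈ D)
    (ht : ∀ d ∈ D, inner ℝ (v + τ • K (Q v) - t) (d - t) ≤ 0) :
    τ * (2 * m - c * τ) * ‖Q v - Q u‖ ^ 2 + ‖(v - t) + τ • K (Q v - Q u)‖ ^ 2
      ≤ ‖v - u‖ ^ 2 - ‖t - u‖ ^ 2 := by
  set Δ := K (Q v - Q u) with hΔ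
  have hΔ' : Δ = K (Q v) - K (Q u) := by rw [hΔ, map_sub]
  have h1 := ht u hu.1
  have h2 := mul_nonpos_of_nonneg_of_nonpos hτ (hu.2 t htD)
  have h3 : 0 ≤ inner ℝ ((v - t) + τ • Δ) (t - u) := by
    have e : inner ℝ ((v - t) + τ • Δ) (t - u) =
        - inner ℝ (v + τ • K (Q v) - t) (u - t) - τ * inner ℝ (K (Q u)) (t - u) := by
      rw [hΔ']
      simp only [inner_sub_left, inner_sub_right, inner_add_left, real_inner_smul_left]
      ring
    rw [e]
    linarith
  have h4 : ‖v - u + τ • Δ‖ ^ 2 = ‖(v - t) + τ • Δ‖ ^ 2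
      + 2 * inner ℝ ((v - t) + τ • Δ) (t - u) + ‖t - u‖ ^ 2 := by
    rw [← norm_add_sq_real]
    congr 2
    abel
  have h5 : ‖v - u + τ • Δ‖ ^ 2 =
      ‖v - u‖ ^ 2 + 2 * (τ * inner ℝ Δ (v - u)) + τ ^ 2 * ‖Δ‖ ^ 2 := by
    rw [norm_add_sq_real, inner_smul_right, real_inner_comm, norm_smul, mul_pow,
      Real.norm_eq_abs, sq_abs]
  have h6 := mul_le_mul_of_nonneg_left (hQ v u) hτ
  have h7 := mul_le_mul_of_nonneg_left (hK (Q v - Q u)) (sq_nonneg τ)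
  rw [← hΔ] at h6 h7
  nlinarith

/-- Convergence of the relaxed forward-backward iteration with summable errors in a
finite-dimensional space. -/
theorem forwardBackward_tendsto [FiniteDimensional ℝ H] {D : Set H} (hD : IsClosed D)
    {P : H → H} (hPD : ∀ y, P y ∈ D)
    (hP : ∀ y, ∀ d ∈ D, inner ℝ (y - P y) (d - P y) ≤ 0)
    {Q : H → G} (hQc : Continuous Q) (K : G →ₗ[ℝ] H) {c m : ℝ}
    (hK : ∀ x, ‖K x‖ ^ 2 ≤ c * ‖x‖ ^ 2)
    (hQ : ∀ v u, m * ‖Q v - Q u‖ ^ 2 ≤ - inner ℝ (K (Q v - Q u)) (v - u))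
    (hne : (viSet D fun u => K (Q u)).Nonempty)
    {ε δ T : ℝ} (hε : 0 < ε) (hδ : 0 < δ) {τ lam : ℕ → ℝ}
    (hτ : ∀ n, ε ≤ τ n) (hτT : ∀ n, τ n ≤ T) (hτδ : ∀ n, δ ≤ 2 * m - c * τ n)
    (hlam : ∀ n, lam n ∈ Set.Icc ε 1) {a : ℕ → H} {b : ℕ → G}
    (ha : Summable fun n => ‖a n‖) (hb : Summable fun n => ‖b n‖) {v : ℕ → H}
    (hv : ∀ n, v (n + 1) =
      v n + lam n • (P (v n + τ n • K (Q (v n) + b n)) + a n - v n)) :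
    ∃ u ∈ viSet D (fun u => K (Q u)), Tendsto v atTop (𝓝 u) := by
  set t : ℕ → H := fun n => P (v n + τ n • K (Q (v n))) with ht
  set e : ℕ → H := fun n => P (v n + τ n • K (Q (v n) + b n)) - t n + a n with he
  have hτ0 : ∀ n, 0 < τ n := fun n => hε.trans_le (hτ n)
  have hT0 : 0 < T := (hτ0 0).trans_le (hτT 0)
  have hKb : ∀ x, ‖K x‖ ≤ Real.sqrt |c| * ‖x‖ := fun x => by
    rw [← Real.sqrt_sq (norm_nonneg x), ← Real.sqrt_mul (abs_nonneg c)]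
    refine Real.le_sqrt_of_sq_le ((hK x).trans ?_)
    gcongr
    exact le_abs_self c
  have hKc : Continuous K := AddMonoidHomClass.continuous_of_bound K _ hKb
  have hes : Summable fun n => ‖e n‖ := by
    refine Summable.of_nonneg_of_le (fun n => norm_nonneg _) (fun n => ?_)
      ((hb.mul_left (T * Real.sqrt |c|)).add ha)
    refine (norm_add_le _ _).trans (add_le_add_left ?_ _)
    refine (norm_sub_le_of_variational hPD hP _ _).trans ?_
    rw [map_add, smul_add, show v n + (τ n • K (Q (v n)) + τ n • K (b n)) -
      (v n + τ n • K (Q (v n))) = τ n • K (b n) by abel, norm_smul,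
      Real.norm_of_nonneg (hτ0 n).le, mul_assoc]
    exact mul_le_mul (hτT n) (hKb _) (norm_nonneg _) hT0.le
  have hstep : ∀ u ∈ viSet D (fun u => K (Q u)), ∀ n,
      τ n * (2 * m - c * τ n) * ‖Q (v n) - Q u‖ ^ 2 +
        ‖(v n - t n) + τ n • K (Q (v n) - Q u)‖ ^ 2 ≤ ‖v n - u‖ ^ 2 - ‖t n - u‖ ^ 2 :=
    fun u hu n => forwardBackward_step K hK hQ (hτ0 n).le hu (hPD _) (hP _)
  have hle : ∀ u ∈ viSet D (fun u => K (Q u)), ∀ n, ‖t n - u‖ ≤ ‖v n - u‖ := by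
    intro u hu n
    have h := hstep u hu n
    have h1 : 0 ≤ τ n * (2 * m - c * τ n) :=
      mul_nonneg (hτ0 n).le (hδ.le.trans (hτδ n))
    have h2 : 0 ≤ τ n * (2 * m - c * τ n) * ‖Q (v n) - Q u‖ ^ 2 := by positivity
    refine le_of_sq_le_sq ?_ (norm_nonneg _)
    nlinarith [sq_nonneg ‖(v n - t n) + τ n • K (Q (v n) - Q u)‖]
  have hrec : ∀ u ∈ viSet D (fun u => K (Q u)), ∀ n,
      ‖v (n + 1) - u‖ ≤ ‖v n - u‖ - ε * (‖v n - u‖ - ‖t n - u‖) + ‖e n‖ := by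
    intro u hu n
    have hl := hlam n
    have hl0 : 0 ≤ lam n := hε.le.trans hl.1
    have hdec : v (n + 1) - u =
        (1 - lam n) • (v n - u) + lam n • (t n - u) + lam n • e n := by
      rw [hv n, he]
      module
    have h1 : ‖v (n + 1) - u‖ ≤
        (1 - lam n) * ‖v n - u‖ + lam n * ‖t n - u‖ + lam n * ‖e n‖ := by
      rw [hdec]
      refine norm_add₃_le.trans (le_of_eq ?_)
      rw [norm_smul, norm_smul, norm_smul, Real.norm_of_nonneg hl0,
        Real.norm_of_nonneg (sub_nonneg.2 hl.2)]
    have h2 := hle u hu n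
    nlinarith [mul_le_mul_of_nonneg_right hl.2 (norm_nonneg (e n)),
      mul_le_mul_of_nonneg_right hl.1 (sub_nonneg.2 h2)]
  have hconv : ∀ u ∈ viSet D (fun u => K (Q u)), ∃ l,
      Tendsto (fun n => ‖v n - u‖) atTop (𝓝 l) := by
    intro u hu
    refine tendsto_of_le_add_summable (fun n => norm_nonneg _) hes fun n => ?_
    have := hrec u hu n
    nlinarith [hle u hu n]
  obtain ⟨u₀, hu₀⟩ := hne
  obtain ⟨l, hl⟩ := hconv u₀ hu₀
  -- the decrease of the distance to `u₀` tends to zero, hence so does `v n - t n`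
  have hdiff : Tendsto (fun n => ‖v n - u₀‖ - ‖t n - u₀‖) atTop (𝓝 0) := by
    have h0 : Tendsto (fun n => ε⁻¹ * (‖v n - u₀‖ - ‖v (n + 1) - u₀‖ + ‖e n‖)) atTop (𝓝 0) := by
      have := ((hl.sub (hl.comp (tendsto_add_atTop_nat 1))).add
        hes.tendsto_atTop_zero).const_mul ε⁻¹
      simpa using this
    refine squeeze_zero (fun n => sub_nonneg.2 (hle u₀ hu₀ n)) (fun n => ?_) h0
    rw [le_inv_mul_iff₀ hε]
    linarith [hrec u₀ hu₀ n]
  have hbddv : ∃ C, ∀ n, ‖v n - u₀‖ ≤ C := by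
    obtain ⟨C, hC⟩ := hl.bddAbove_range
    exact ⟨C, fun n => hC ⟨n, rfl⟩⟩
  obtain ⟨C, hC⟩ := hbddv
  have hsq : Tendsto (fun n => ‖v n - u₀‖ ^ 2 - ‖t n - u₀‖ ^ 2) atTop (𝓝 0) := by
    refine squeeze_zero (g := fun n => (2 * C) * (‖v n - u₀‖ - ‖t n - u₀‖)) (fun n => ?_)
      (fun n => ?_) (by simpa using hdiff.const_mul (2 * C))
    · have := hle u₀ hu₀ n
      exact sub_nonneg.2 (by gcongr)
    · have h1 := hle u₀ hu₀ n
      have h2 := hC n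
      nlinarith
  have hQu : Tendsto (fun n => Q (v n) - Q u₀) atTop (𝓝 0) := by
    refine tendsto_zero_iff_norm_tendsto_zero.2 ?_
    have h0 : Tendsto (fun n => ‖Q (v n) - Q u₀‖ ^ 2) atTop (𝓝 0) := by
      refine squeeze_zero (g := fun n => (ε * δ)⁻¹ * (‖v n - u₀‖ ^ 2 - ‖t n - u₀‖ ^ 2))
        (fun n => by positivity) (fun n => ?_) (by simpa using hsq.const_mul (ε * δ)⁻¹)
      rw [le_inv_mul_iff₀ (by positivity)]
      have h1 : ε * δ ≤ τ n * (2 * m - c * τ n) :=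
        mul_le_mul (hτ n) (hτδ n) hδ.le (hτ0 n).le
      have h2 := mul_le_mul_of_nonneg_right h1 (sq_nonneg ‖Q (v n) - Q u₀‖)
      nlinarith [hstep u₀ hu₀ n, sq_nonneg ‖(v n - t n) + τ n • K (Q (v n) - Q u₀)‖]
    simpa using h0.sqrt
  have hr : Tendsto (fun n => (v n - t n) + τ n • K (Q (v n) - Q u₀)) atTop (𝓝 0) := by
    refine tendsto_zero_iff_norm_tendsto_zero.2 ?_
    have h0 : Tendsto (fun n => ‖(v n - t n) + τ n • K (Q (v n) - Q u₀)‖ ^ 2) atTop (𝓝 0) := by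
      refine squeeze_zero (fun n => by positivity) (fun n => ?_) hsq
      have h1 : 0 ≤ τ n * (2 * m - c * τ n) :=
        mul_nonneg (hτ0 n).le (hδ.le.trans (hτδ n))
      have h2 : 0 ≤ τ n * (2 * m - c * τ n) * ‖Q (v n) - Q u₀‖ ^ 2 := by positivity
      linarith [hstep u₀ hu₀ n]
    simpa using h0.sqrt
  have hτK : Tendsto (fun n => τ n • K (Q (v n) - Q u₀)) atTop (𝓝 0) := by
    have h1 : Tendsto (fun n => K (Q (v n) - Q u₀)) atTop (𝓝 0) := by
      simpa only [map_zero, Function.comp_def] using (hKc.tendsto 0).comp hQu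
    refine squeeze_zero_norm (a := fun n => T * ‖K (Q (v n) - Q u₀)‖) (fun n => ?_)
      (by simpa using h1.norm.const_mul T)
    rw [norm_smul, Real.norm_of_nonneg (hτ0 n).le]
    gcongr
    exact hτT n
  have hvt : Tendsto (fun n => v n - t n) atTop (𝓝 0) := by
    simpa using hr.sub hτK
  -- every cluster point solves the variational inequality
  obtain ⟨u, -, φ, hφ, hu⟩ := tendsto_subseq_of_bounded
    (Metric.isBounded_closedBall (x := u₀) (r := C)) (x := v) fun n => by
      rw [Metric.mem_closedBall, dist_eq_norm]; exact hC n
  have htu : Tendsto (t ∘ φ) atTop (𝓝 u) := by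
    have := hu.sub (hvt.comp hφ.tendsto_atTop)
    simpa [Function.comp_def] using this
  have huD : u ∈ D := hD.mem_of_tendsto htu (Eventually.of_forall fun n => hPD _)
  have huS : u ∈ viSet D (fun u => K (Q u)) := by
    refine ⟨huD, fun d hd => ?_⟩
    have hineq : ∀ n, inner ℝ ((τ n)⁻¹ • (v n - t n) + K (Q (v n))) (d - t n) ≤ 0 := by
      intro n
      have h1 := hP (v n + τ n • K (Q (v n))) d hd
      have h2 : (τ n)⁻¹ • (v n - t n) + K (Q (v n)) =
          (τ n)⁻¹ • (v n + τ n • K (Q (v n)) - t n) := by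
        rw [show v n + τ n • K (Q (v n)) - t n = (v n - t n) + τ n • K (Q (v n)) by abel,
          smul_add, inv_smul_smul₀ (hτ0 n).ne']
      rw [h2, real_inner_smul_left]
      exact mul_nonpos_of_nonneg_of_nonpos (inv_nonneg.2 (hτ0 n).le) h1
    have h1 : Tendsto (fun n => (τ n)⁻¹ • (v n - t n)) atTop (𝓝 0) := by
      refine squeeze_zero_norm (a := fun n => ε⁻¹ * ‖v n - t n‖) (fun n => ?_)
        (by simpa using hvt.norm.const_mul ε⁻¹)
      rw [norm_smul, Real.norm_of_nonneg (inv_nonneg.2 (hτ0 n).le)]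
      gcongr
      exact hτ n
    have h2 : Tendsto (fun n => K (Q (v (φ n)))) atTop (𝓝 (K (Q u))) :=
      ((hKc.comp hQc).tendsto u).comp hu
    have h3 := ((h1.comp hφ.tendsto_atTop).add h2).inner (htu.const_sub d) (𝕜 := ℝ)
    rw [zero_add] at h3
    exact le_of_tendsto h3 (Eventually.of_forall fun n => hineq (φ n))
  refine ⟨u, huS, ?_⟩
  obtain ⟨l', hl'⟩ := hconv u huS
  have h0 : Tendsto (fun n => ‖v (φ n) - u‖) atTop (𝓝 0) := by
    simpa using (hu.sub_const u).norm
  have hl0 : l' = 0 := tendsto_nhds_unique (hl'.comp hφ.tendsto_atTop) h0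
  rw [hl0] at hl'
  exact tendsto_iff_norm_sub_tendsto_zero.2 hl'

end ForwardBackward

/-! ### Discrete gradient and divergence -/

section GradDiv

variable {N : ℕ}

theorem grad_fst (x : Img N) (kl : Fin N × Fin N) : (grad x).fst kl =
    if h : kl.1.val + 1 < N then x (⟨kl.1.val + 1, h⟩, kl.2) - x kl else 0 := rfl

theorem grad_snd (x : Img N) (kl : Fin N × Fin N) : (grad x).snd kl =
    if h : kl.2.val + 1 < N then x (kl.1, ⟨kl.2.val + 1, h⟩) - x kl else 0 := rfl

theorem fld_ext {y y' : Fld N} (h₁ : ∀ kl, y.fst kl = y'.fst kl)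
    (h₂ : ∀ kl, y.snd kl = y'.snd kl) : y = y' :=
  (WithLp.equiv 2 _).injective (Prod.ext (PiLp.ext h₁) (PiLp.ext h₂))

/-- The discrete gradient as a linear map. -/
noncomputable def gradLM (N : ℕ) : Img N →ₗ[ℝ] Fld N where
  toFun := grad
  map_add' x y := by
    refine fld_ext (fun kl => ?_) (fun kl => ?_) <;>
    simp only [grad_fst, grad_snd, WithLp.add_fst, WithLp.add_snd, PiLp.add_apply] <;>
    split_ifs <;> ring
  map_smul' c x := by
    refine fld_ext (fun kl => ?_) (fun kl => ?_) <;>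
    simp only [grad_fst, grad_snd, WithLp.smul_fst, WithLp.smul_snd, PiLp.smul_apply,
      RingHom.id_apply, smul_eq_mul] <;>
    split_ifs <;> ring

/-- The discrete divergence as a linear map. -/
noncomputable def dvgLM (N : ℕ) : Fld N →ₗ[ℝ] Img N where
  toFun := dvg
  map_add' x y := by
    ext kl
    simp only [dvg, WithLp.add_fst, WithLp.add_snd, PiLp.add_apply]
    split_ifs <;> ring
  map_smul' c x := by
    ext kl
    simp only [dvg, WithLp.smul_fst, WithLp.smul_snd, PiLp.smul_apply,
      RingHom.id_apply, smul_eq_mul]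
    split_ifs <;> ring

theorem continuous_dvg : Continuous (dvg : Fld N → Img N) := by
  unfold dvg
  refine (PiLp.continuous_toLp 2 _).comp (continuous_pi fun kl => ?_)
  split_ifs <;> fun_prop

theorem dvg_sub (y y' : Fld N) : dvg (y - y') = dvg y - dvg y' := map_sub (dvgLM N) y y'

/-- Summation by parts in one variable, with the boundary conventions of `grad` and `dvg`. -/
theorem sum_forward_diff_mul (hN : 2 ≤ N) (a b : Fin N → ℝ) :
    ∑ k : Fin N, (if h : k.val + 1 < N then a ⟨k.val + 1, h⟩ - a k else 0) * b k =
      - ∑ k : Fin N, a k * (if k.val = 0 then b k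
        else if k.val + 1 < N then b k - b (prevIdx k) else - b (prevIdx k)) := by
  have h1 : ∀ k : Fin N, (if h : k.val + 1 < N then a ⟨k.val + 1, h⟩ - a k else 0) * b k =
      (if h : k.val + 1 < N then a ⟨k.val + 1, h⟩ * b k else 0) -
        (if k.val + 1 < N then a k * b k else 0) := by
    intro k; split_ifs <;> ring
  have h2 : ∀ k : Fin N, a k * (if k.val = 0 then b k
        else if k.val + 1 < N then b k - b (prevIdx k) else - b (prevIdx k)) =
      (if k.val + 1 < N then a k * b k else 0) -
        (if k.val = 0 then 0 else a k * b (prevIdx k)) := by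
    intro k; split_ifs <;> first | omega | ring
  have h3 : ∑ k : Fin N, (if h : k.val + 1 < N then a ⟨k.val + 1, h⟩ * b k else 0) =
      ∑ k : Fin N, (if k.val = 0 then 0 else a k * b (prevIdx k)) := by
    obtain ⟨M, rfl⟩ : ∃ M, N = M + 1 := ⟨N - 1, by omega⟩
    rw [Fin.sum_univ_castSucc, Fin.sum_univ_succ]
    simp only [Fin.val_castSucc, Fin.val_last, lt_irrefl, dite_false, add_zero, Fin.val_zero,
      if_true, zero_add, Fin.val_succ, Nat.add_one_ne_zero, if_false]
    refine Finset.sum_congr rfl fun k _ => ?_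
    rw [dif_pos (by omega)]
    rfl
  simp only [h1, h2, Finset.sum_sub_distrib, h3]
  ring

/-- The divergence is minus the adjoint of the gradient. -/
theorem inner_grad (hN : 2 ≤ N) (x : Img N) (y : Fld N) :
    inner ℝ (grad x) y = - inner ℝ x (dvg y) := by
  have e₁ : inner ℝ (grad x) y = ∑ l : Fin N, ∑ k : Fin N,
      (if h : k.val + 1 < N then x (⟨k.val + 1, h⟩, l) - x (k, l) else 0) * y.fst (k, l) +
      ∑ k : Fin N, ∑ l : Fin N,
      (if h : l.val + 1 < N then x (k, ⟨l.val + 1, h⟩) - x (k, l) else 0) * y.snd (k, l) := by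
    rw [WithLp.prod_inner_apply, PiLp.inner_apply, PiLp.inner_apply, Fintype.sum_prod_type,
      Fintype.sum_prod_type, Finset.sum_comm]
    simp only [RCLike.inner_apply, conj_trivial, mul_comm]
    rfl
  have e₂ : inner ℝ x (dvg y) = ∑ l : Fin N, ∑ k : Fin N, x (k, l) *
      (if k.val = 0 then y.fst (k, l)
      else if k.val + 1 < N then y.fst (k, l) - y.fst (prevIdx k, l)
      else - y.fst (prevIdx k, l)) +
      ∑ k : Fin N, ∑ l : Fin N, x (k, l) *
      (if l.val = 0 then y.snd (k, l)
      else if l.val + 1 < N then y.snd (k, l) - y.snd (k, prevIdx l)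
      else - y.snd (k, prevIdx l)) := by
    rw [Finset.sum_comm, PiLp.inner_apply, Fintype.sum_prod_type, ← Finset.sum_add_distrib]
    refine Finset.sum_congr rfl fun k _ => ?_
    rw [← Finset.sum_add_distrib]
    refine Finset.sum_congr rfl fun l _ => ?_
    rw [← mul_add, mul_comm]
    rfl
  rw [e₁, e₂, neg_add, ← Finset.sum_neg_distrib, ← Finset.sum_neg_distrib]
  congr 1
  · exact Finset.sum_congr rfl fun l _ =>
      sum_forward_diff_mul hN (fun k => x (k, l)) fun k => y.fst (k, l)
  · exact Finset.sum_congr rfl fun k _ =>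
      sum_forward_diff_mul hN (fun l => x (k, l)) fun l => y.snd (k, l)

theorem sum_forward_diff_sq_le (a : Fin N → ℝ) :
    ∑ k : Fin N, (if h : k.val + 1 < N then a ⟨k.val + 1, h⟩ - a k else 0) ^ 2 ≤
      4 * ∑ k : Fin N, a k ^ 2 := by
  rcases N with _ | M
  · simp
  have h1 : ∑ k : Fin (M + 1), (if h : k.val + 1 < M + 1 then a ⟨k.val + 1, h⟩ - a k else 0) ^ 2 ≤
      2 * ∑ k : Fin M, a k.succ ^ 2 + 2 * ∑ k : Fin M, a k.castSucc ^ 2 := by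
    rw [Fin.sum_univ_castSucc, Finset.mul_sum, Finset.mul_sum, ← Finset.sum_add_distrib]
    simp only [Fin.val_castSucc, Fin.val_last, lt_irrefl, dite_false, ne_eq, OfNat.ofNat_ne_zero,
      not_false_eq_true, zero_pow, add_zero]
    refine Finset.sum_le_sum fun k _ => ?_
    rw [dif_pos (by omega)]
    change (a k.succ - a k.castSucc) ^ 2 ≤ _
    nlinarith [sq_nonneg (a k.succ + a k.castSucc)]
  have h2 := Fin.sum_univ_succ fun k => a k ^ 2
  have h3 := Fin.sum_univ_castSucc fun k => a k ^ 2
  nlinarith [sq_nonneg (a 0), sq_nonneg (a (Fin.last M))]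

/-- Each pixel enters at most four forward differences, and `(s - t)² ≤ 2 s² + 2 t²`. -/
theorem norm_grad_sq_le (x : Img N) : ‖grad x‖ ^ 2 ≤ 8 * ‖x‖ ^ 2 := by
  rw [WithLp.prod_norm_sq_eq_of_L2, EuclideanSpace.norm_sq_eq, EuclideanSpace.norm_sq_eq,
    EuclideanSpace.norm_sq_eq]
  simp only [Real.norm_eq_abs, sq_abs, grad_fst, grad_snd, Fintype.sum_prod_type]
  have h1 : ∑ k : Fin N, ∑ l : Fin N,
      (if h : k.val + 1 < N then x (⟨k.val + 1, h⟩, l) - x (k, l) else 0) ^ 2 ≤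
      4 * ∑ k : Fin N, ∑ l : Fin N, x (k, l) ^ 2 := by
    rw [Finset.sum_comm, Finset.sum_comm (f := fun k l => x (k, l) ^ 2), Finset.mul_sum]
    exact Finset.sum_le_sum fun l _ => sum_forward_diff_sq_le fun k => x (k, l)
  have h2 : ∑ k : Fin N, ∑ l : Fin N,
      (if h : l.val + 1 < N then x (k, ⟨l.val + 1, h⟩) - x (k, l) else 0) ^ 2 ≤
      4 * ∑ k : Fin N, ∑ l : Fin N, x (k, l) ^ 2 := by
    rw [Finset.mul_sum]
    exact Finset.sum_le_sum fun k _ => sum_forward_diff_sq_le fun l => x (k, l)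
  linarith

theorem continuous_gradLM : Continuous (gradLM N) :=
  AddMonoidHomClass.continuous_of_bound (gradLM N) (Real.sqrt 8) fun x => by
    rw [← Real.sqrt_sq (norm_nonneg x), ← Real.sqrt_mul (by norm_num)]
    exact Real.le_sqrt_of_sq_le (norm_grad_sq_le x)

end GradDiv

/-! ### Planar `ℓ^q` norms, Hölder duality, and pixelwise projection -/

section PairNorm

theorem pairNorm_eq_norm (q : ℝ≥0∞) [hq : Fact (1 ≤ q)] (s t : ℝ) :
    pairNorm q s t = ‖(WithLp.toLp q (s, t) : WithLp q (ℝ × ℝ))‖ := by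
  by_cases h : q = ⊤
  · subst h
    rw [WithLp.prod_norm_eq_sup]
    simp [pairNorm]
  · rw [WithLp.prod_norm_eq_add (ENNReal.toReal_pos (one_pos.trans_le hq.out).ne' h)]
    simp [pairNorm, h]

theorem continuous_pairNorm (q : ℝ≥0∞) [Fact (1 ≤ q)] :
    Continuous fun y : ℝ × ℝ => pairNorm q y.1 y.2 := by
  simp only [pairNorm_eq_norm]
  exact continuous_norm.comp (WithLp.prod_continuous_toLp q ℝ ℝ)

theorem pairNorm_zero (q : ℝ≥0∞) [Fact (1 ≤ q)] : pairNorm q 0 0 = 0 := by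
  rw [pairNorm_eq_norm]
  exact norm_zero

theorem abs_fst_le_pairNorm (q : ℝ≥0∞) [Fact (1 ≤ q)] (s t : ℝ) : |s| ≤ pairNorm q s t := by
  rw [pairNorm_eq_norm]
  exact WithLp.norm_fst_le ℝ (WithLp.toLp q (s, t))

theorem abs_snd_le_pairNorm (q : ℝ≥0∞) [Fact (1 ≤ q)] (s t : ℝ) : |t| ≤ pairNorm q s t := by
  rw [pairNorm_eq_norm]
  exact WithLp.norm_snd_le ℝ (WithLp.toLp q (s, t))

theorem pairNorm_combo_le_one (q : ℝ≥0∞) [Fact (1 ≤ q)] {s t s' t' a b : ℝ}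
    (h : pairNorm q s t ≤ 1) (h' : pairNorm q s' t' ≤ 1) (ha : 0 ≤ a) (hb : 0 ≤ b)
    (hab : a + b = 1) : pairNorm q (a * s + b * s') (a * t + b * t') ≤ 1 := by
  rw [pairNorm_eq_norm] at *
  have hc := convex_closedBall (0 : WithLp q (ℝ × ℝ)) 1
    (mem_closedBall_zero_iff.2 h) (mem_closedBall_zero_iff.2 h') ha hb hab
  exact mem_closedBall_zero_iff.1 hc

/-- Hölder's inequality in the plane. -/
theorem mul_add_mul_le_pairNorm_mul (p : ℝ≥0∞) (hp : 1 ≤ p) (s t a b : ℝ) :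
    s * a + t * b ≤ pairNorm p s t * pairNorm p.conjExponent a b := by
  have hs := le_abs_self (s * a)
  have ht := le_abs_self (t * b)
  rw [abs_mul] at hs ht
  rcases hp.eq_or_lt with h1 | h1
  · subst h1
    have : ENNReal.conjExponent 1 = ⊤ := by simp [ENNReal.conjExponent]
    simp only [this, pairNorm, ENNReal.one_ne_top, if_false, if_true, ENNReal.toReal_one,
      Real.rpow_one, div_one]
    nlinarith [mul_le_mul_of_nonneg_left (le_max_left |a| |b|) (abs_nonneg s),
      mul_le_mul_of_nonneg_left (le_max_right |a| |b|) (abs_nonneg t)]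
  by_cases h2 : p = ⊤
  · subst h2
    have : ENNReal.conjExponent ⊤ = 1 := by simp [ENNReal.conjExponent]
    simp only [this, pairNorm, ENNReal.one_ne_top, if_false, if_true, ENNReal.toReal_one,
      Real.rpow_one, div_one]
    nlinarith [mul_le_mul_of_nonneg_right (le_max_left |s| |t|) (abs_nonneg a),
      mul_le_mul_of_nonneg_right (le_max_right |s| |t|) (abs_nonneg b)]
  have : p.HolderConjugate p.conjExponent := .conjExponent hp
  have hq : p.conjExponent ≠ ⊤ := by
    simpa [ENNReal.conjExponent, tsub_eq_zero_iff_le] using h1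
  have hpq : p.toReal.HolderConjugate p.conjExponent.toReal :=
    ENNReal.HolderConjugate.toReal_of_ne_top h2 hq
  have := Real.inner_le_Lp_mul_Lq Finset.univ ![s, t] ![a, b] hpq
  simpa [pairNorm, h2, hq, Fin.sum_univ_two] using this

/-- Equality is attained in Hölder's inequality by a vector of the dual unit ball. -/
theorem exists_dual_pair (p : ℝ≥0∞) (hp : 1 ≤ p) (s t : ℝ) :
    ∃ a b : ℝ, pairNorm p.conjExponent a b ≤ 1 ∧ s * a + t * b = pairNorm p s t := by
  rcases hp.eq_or_lt with h1 | h1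
  · subst h1
    have : ENNReal.conjExponent 1 = ⊤ := by simp [ENNReal.conjExponent]
    refine ⟨SignType.sign s, SignType.sign t, ?_, ?_⟩
    · simp only [this, pairNorm, if_true]
      refine max_le ?_ ?_
      · rcases SignType.sign s with _ | _ | _ <;> simp
      · rcases SignType.sign t with _ | _ | _ <;> simp
    · simp [pairNorm]
  by_cases h2 : p = ⊤
  · subst h2
    have : ENNReal.conjExponent ⊤ = 1 := by simp [ENNReal.conjExponent]
    have hsign : ∀ r : ℝ, |(SignType.sign r : ℝ)| ≤ 1 := fun r => by
      rcases SignType.sign r with _ | _ | _ <;> simp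
    rcases le_total |s| |t| with h | h
    · refine ⟨0, SignType.sign t, ?_, ?_⟩
      · simpa [this, pairNorm] using hsign t
      · simp [pairNorm, max_eq_right h]
    · refine ⟨SignType.sign s, 0, ?_, ?_⟩
      · simpa [this, pairNorm] using hsign s
      · simp [pairNorm, max_eq_left h]
  have : p.HolderConjugate p.conjExponent := .conjExponent hp
  have hq : p.conjExponent ≠ ⊤ := by
    simpa [ENNReal.conjExponent, tsub_eq_zero_iff_le] using h1
  have hpq : p.toReal.HolderConjugate p.conjExponent.toReal :=
    ENNReal.HolderConjugate.toReal_of_ne_top h2 hq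
  simp only [pairNorm, h2, hq, if_false]
  set P := p.toReal
  set R := p.conjExponent.toReal
  set S := |s| ^ P + |t| ^ P with hS
  have hS0 : 0 ≤ S := by positivity
  rcases hS0.eq_or_lt with h0 | h0
  · refine ⟨0, 0, ?_, ?_⟩
    · simp [Real.zero_rpow hpq.symm.ne_zero, Real.zero_rpow hpq.symm.inv_ne_zero]
    · rw [← h0, Real.zero_rpow hpq.one_div_ne_zero]; ring
  -- the extremal vector is `S^(-1/R) (sign s |s|^(P-1), sign t |t|^(P-1))`, and `(P-1) R = P`
  have hsign : ∀ r : ℝ, |S ^ (-(1 / R)) * (SignType.sign r * |r| ^ (P - 1))| ^ R ≤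
      S⁻¹ * |r| ^ P := by
    intro r
    rw [abs_mul, abs_of_nonneg (by positivity : 0 ≤ S ^ (-(1 / R))),
      Real.mul_rpow (by positivity) (by positivity), ← Real.rpow_mul hS0,
      show -(1 / R) * R = -1 by field_simp [hpq.symm.ne_zero], Real.rpow_neg_one]
    gcongr
    rw [show |r| ^ P = (|r| ^ (P - 1)) ^ R by
      rw [← Real.rpow_mul (abs_nonneg r), hpq.sub_one_mul_conj]]
    refine Real.rpow_le_rpow (abs_nonneg _) ?_ hpq.symm.nonneg
    rw [abs_mul, abs_of_nonneg (by positivity : 0 ≤ |r| ^ (P - 1))]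
    refine mul_le_of_le_one_left (by positivity) ?_
    rcases SignType.sign r with _ | _ | _ <;> simp
  have hprod : ∀ r : ℝ, r * (S ^ (-(1 / R)) * (SignType.sign r * |r| ^ (P - 1))) =
      S ^ (-(1 / R)) * |r| ^ P := by
    intro r
    rcases eq_or_ne r 0 with rfl | hr
    · simp [Real.zero_rpow hpq.ne_zero]
    · rw [show P = 1 + (P - 1) by ring, Real.rpow_add (abs_pos.2 hr), Real.rpow_one,
        show 1 + (P - 1) - 1 = P - 1 by ring]
      calc _ = S ^ (-(1 / R)) * ((r * SignType.sign r) * |r| ^ (P - 1)) := by ring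
        _ = _ := by rw [self_mul_sign]
  refine ⟨S ^ (-(1 / R)) * (SignType.sign s * |s| ^ (P - 1)),
    S ^ (-(1 / R)) * (SignType.sign t * |t| ^ (P - 1)), ?_, ?_⟩
  · refine Real.rpow_le_one (by positivity) ?_ (by have := hpq.symm.pos; positivity)
    refine (add_le_add (hsign s) (hsign t)).trans (le_of_eq ?_)
    rw [← mul_add, ← hS, inv_mul_cancel₀ h0.ne']
  · rw [hprod, hprod, ← mul_add, ← hS]
    nth_rewrite 2 [← Real.rpow_one S]
    rw [← Real.rpow_add h0]
    congr 1
    have := hpq.inv_add_inv_eq_one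
    rw [one_div, one_div]
    linarith

/-- The projection onto a closed convex set satisfies its variational characterization. -/
theorem proj_spec {E : Type*} [NormedAddCommGroup E] [InnerProductSpace ℝ E] [CompleteSpace E]
    {C : Set E} (hne : C.Nonempty) (hcl : IsClosed C) (hcv : Convex ℝ C) (x : E) :
    proj C x ∈ C ∧ ∀ d ∈ C, inner ℝ (x - proj C x) (d - proj C x) ≤ 0 := by
  have hinf : Metric.infDist x C = ⨅ w : C, ‖x - w‖ := by
    rw [Metric.infDist_eq_iInf]
    simp only [dist_eq_norm]
  have hex : ∃ q : E, q ∈ C ∧ ‖x - q‖ = Metric.infDist x C := by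
    obtain ⟨q, hq, h⟩ := exists_norm_eq_iInf_of_complete_convex hne hcl.isComplete hcv x
    exact ⟨q, hq, h.trans hinf.symm⟩
  obtain ⟨h1, h2⟩ : proj C x ∈ C ∧ ‖x - proj C x‖ = Metric.infDist x C :=
    Classical.epsilon_spec hex
  exact ⟨h1, (norm_eq_iInf_iff_real_inner_le_zero hcv h1).1 (h2.trans hinf)⟩

theorem one_le_conjExponent (p : ℝ≥0∞) : 1 ≤ p.conjExponent := le_self_add

/-- The variational characterization of `pairProj`, in coordinates. -/
theorem pairProj_spec (p : ℝ≥0∞) (s t : ℝ) :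
    pairNorm p.conjExponent (pairProj p s t 0) (pairProj p s t 1) ≤ 1 ∧
      ∀ a b : ℝ, pairNorm p.conjExponent a b ≤ 1 →
        (s - pairProj p s t 0) * (a - pairProj p s t 0) +
          (t - pairProj p s t 1) * (b - pairProj p s t 1) ≤ 0 := by
  have : Fact (1 ≤ p.conjExponent) := ⟨one_le_conjExponent p⟩
  have hcl : IsClosed (lpBall p.conjExponent) :=
    isClosed_le ((continuous_pairNorm p.conjExponent).comp
      (f := fun y : EuclideanSpace ℝ (Fin 2) => (y 0, y 1)) (by fun_prop)) continuous_const
  have hcv : Convex ℝ (lpBall p.conjExponent) := fun y hy y' hy' a b ha hb hab =>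
    pairNorm_combo_le_one p.conjExponent hy hy' ha hb hab
  have hne : (lpBall p.conjExponent).Nonempty :=
    ⟨0, (pairNorm_zero p.conjExponent).trans_le zero_le_one⟩
  obtain ⟨h1, h2⟩ := proj_spec hne hcl hcv !₂[s, t]
  refine ⟨h1, fun a b hab => ?_⟩
  have h := h2 !₂[a, b] hab
  rw [PiLp.inner_apply, Fin.sum_univ_two] at h
  simp only [RCLike.inner_apply, conj_trivial] at h
  rw [mul_comm (a := s - _), mul_comm (a := t - _)]
  exact h

variable {N : ℕ}

theorem inner_fld (y y' : Fld N) : inner ℝ y y' = ∑ k : Fin N, ∑ l : Fin N,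
    (y.fst (k, l) * y'.fst (k, l) + y.snd (k, l) * y'.snd (k, l)) := by
  rw [WithLp.prod_inner_apply, PiLp.inner_apply, PiLp.inner_apply, ← Finset.sum_add_distrib,
    Fintype.sum_prod_type]
  simp only [RCLike.inner_apply, conj_trivial]
  refine Finset.sum_congr rfl fun k _ => Finset.sum_congr rfl fun l _ => ?_
  exact congrArg₂ (· + ·) (mul_comm _ _) (mul_comm _ _)

theorem convex_dualSet (p : ℝ≥0∞) : Convex ℝ (dualSet N p) := by
  have : Fact (1 ≤ p.conjExponent) := ⟨one_le_conjExponent p⟩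
  exact fun y hy y' hy' a b ha hb hab k l =>
    pairNorm_combo_le_one p.conjExponent (hy k l) (hy' k l) ha hb hab

theorem isClosed_dualSet (p : ℝ≥0∞) : IsClosed (dualSet N p) := by
  have : Fact (1 ≤ p.conjExponent) := ⟨one_le_conjExponent p⟩
  have : dualSet N p = ⋂ k : Fin N, ⋂ l : Fin N,
      {v : Fld N | pairNorm p.conjExponent (v.fst (k, l)) (v.snd (k, l)) ≤ 1} := by
    ext v
    simp [dualSet]
  rw [this]
  refine isClosed_iInter fun k => isClosed_iInter fun l => ?_
  exact isClosed_le ((continuous_pairNorm p.conjExponent).comp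
    (f := fun v : Fld N => (v.fst (k, l), v.snd (k, l))) (by fun_prop)) continuous_const

theorem isCompact_dualSet (p : ℝ≥0∞) : IsCompact (dualSet N p) := by
  have : Fact (1 ≤ p.conjExponent) := ⟨one_le_conjExponent p⟩
  refine Metric.isCompact_of_isClosed_isBounded (isClosed_dualSet p) ?_
  refine (Metric.isBounded_closedBall (x := (0 : Fld N))
    (r := Real.sqrt (∑ _k : Fin N, ∑ _l : Fin N, 2))).subset fun v hv => ?_
  rw [mem_closedBall_zero_iff]
  refine Real.le_sqrt_of_sq_le ?_
  rw [← real_inner_self_eq_norm_sq, inner_fld]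
  refine Finset.sum_le_sum fun k _ => Finset.sum_le_sum fun l _ => ?_
  have h1 := abs_le.1 ((abs_fst_le_pairNorm _ _ _).trans (hv k l))
  have h2 := abs_le.1 ((abs_snd_le_pairNorm _ _ _).trans (hv k l))
  nlinarith

theorem dualSet_nonempty (p : ℝ≥0∞) : (dualSet N p).Nonempty := by
  have : Fact (1 ≤ p.conjExponent) := ⟨one_le_conjExponent p⟩
  exact ⟨0, fun k l => (pairNorm_zero p.conjExponent).trans_le zero_le_one⟩

/-- The field obtained by projecting every pixel of `y` onto the unit `ℓ^{p*}` ball; it is the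
projection of `y` onto `dualSet N p`. -/
noncomputable def fldProj (p : ℝ≥0∞) (y : Fld N) : Fld N :=
  WithLp.toLp 2 (WithLp.toLp 2 (fun kl => pairProj p (y.fst kl) (y.snd kl) 0),
    WithLp.toLp 2 (fun kl => pairProj p (y.fst kl) (y.snd kl) 1))

theorem fldProj_mem (p : ℝ≥0∞) (y : Fld N) : fldProj p y ∈ dualSet N p :=
  fun k l => (pairProj_spec p (y.fst (k, l)) (y.snd (k, l))).1

theorem inner_sub_fldProj_le (p : ℝ≥0∞) (y d : Fld N) (hd : d ∈ dualSet N p) :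
    inner ℝ (y - fldProj p y) (d - fldProj p y) ≤ 0 := by
  rw [inner_fld]
  exact Finset.sum_nonpos fun k _ => Finset.sum_nonpos fun l _ =>
    (pairProj_spec p (y.fst (k, l)) (y.snd (k, l))).2 _ _ (hd k l)

theorem inner_le_normPOne {p : ℝ≥0∞} (hp : 1 ≤ p) (y : Fld N) {v : Fld N}
    (hv : v ∈ dualSet N p) : inner ℝ y v ≤ normPOne p y := by
  have : Fact (1 ≤ p) := ⟨hp⟩
  rw [inner_fld]
  refine Finset.sum_le_sum fun k _ => Finset.sum_le_sum fun l _ => ?_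
  refine (mul_add_mul_le_pairNorm_mul p hp _ _ _ _).trans ?_
  exact mul_le_of_le_one_right
    ((abs_nonneg _).trans (abs_fst_le_pairNorm p _ _)) (hv k l)

theorem exists_inner_eq_normPOne {p : ℝ≥0∞} (hp : 1 ≤ p) (y : Fld N) :
    ∃ v ∈ dualSet N p, inner ℝ y v = normPOne p y := by
  choose a b hab hy using exists_dual_pair p hp
  refine ⟨WithLp.toLp 2 (WithLp.toLp 2 (fun kl => a (y.fst kl) (y.snd kl)),
    WithLp.toLp 2 (fun kl => b (y.fst kl) (y.snd kl))), fun k l => hab _ _, ?_⟩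
  rw [inner_fld]
  exact Finset.sum_congr rfl fun k _ => Finset.sum_congr rfl fun l _ => hy _ _

end PairNorm

/-! ### Primal and dual solutions -/

section Duality

variable {N : ℕ} {f : Img N → EReal} {μ : ℝ} {z : Img N} {p : ℝ≥0∞}

/-- The primal point `prox f (z + μ div v)` attached to the dual variable `v`. -/
noncomputable def primalPoint (f : Img N → EReal) (μ : ℝ) (z : Img N) (v : Fld N) : Img N :=
  prox f (z + μ • dvg v)

/-- The solutions `v ∈ D_p` of `⟨∇ x(v), d - v⟩ ≤ 0` for all `d ∈ D_p`, where
`x(v) = primalPoint f μ z v`: the first-order optimality condition of the dual problem. -/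
def dualVI (f : Img N → EReal) (μ : ℝ) (z : Img N) (p : ℝ≥0∞) : Set (Fld N) :=
  viSet (dualSet N p) fun v => gradLM N (primalPoint f μ z v)

theorem continuous_primalPoint (hf : IsGammaZero f) : Continuous (primalPoint f μ z) :=
  (continuous_prox hf).comp (continuous_const.add (continuous_dvg.const_smul μ))

theorem dualObj_eq (hf : IsGammaZero f) (v : Fld N) :
    dualObj f μ z v = conjEnvelope f (z + μ • dvg v) :=
  moreauEnvelope_conjugate hf _

theorem inner_smul_dvg_sub (hN : 2 ≤ N) (x : Img N) (v v' : Fld N) :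
    inner ℝ x (z + μ • dvg v' - (z + μ • dvg v)) = - (μ * inner ℝ (grad x) (v' - v)) := by
  rw [inner_grad hN, add_sub_add_left_eq_sub, ← smul_sub, ← dvg_sub, real_inner_smul_right]
  ring

theorem inner_grad_primalPoint_sub_le (hN : 2 ≤ N) (hf : IsGammaZero f) (hμ : 0 < μ)
    (v u : Fld N) : μ⁻¹ * ‖primalPoint f μ z v - primalPoint f μ z u‖ ^ 2 ≤
      - inner ℝ (gradLM N (primalPoint f μ z v - primalPoint f μ z u)) (v - u) := by
  have h := norm_prox_sub_sq_le hf (z + μ • dvg v) (z + μ • dvg u)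
  rw [inner_smul_dvg_sub hN] at h
  rw [inv_mul_le_iff₀ hμ, mul_neg]
  exact h

/-- The dual objective is continuous on the compact set `D_p`, hence has a minimizer there, and a
minimizer satisfies the first-order condition. -/
theorem dualVI_nonempty (hN : 2 ≤ N) (hf : IsGammaZero f) (hμ : 0 < μ) :
    (dualVI f μ z p).Nonempty := by
  have hcont : Continuous fun v : Fld N => conjEnvelope f (z + μ • dvg v) :=
    (continuous_conjEnvelope hf).comp (continuous_const.add (continuous_dvg.const_smul μ))
  obtain ⟨u, hu, hmin⟩ := (isCompact_dualSet (N := N) p).exists_isMinOn (dualSet_nonempty p)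
    hcont.continuousOn
  refine ⟨u, hu, fun d hd => ?_⟩
  -- minimality along the segment from `u` to `d`, and the subgradient inequality at its points
  have key : ∀ t : ℝ, 0 < t → t ≤ 1 →
      inner ℝ (gradLM N (primalPoint f μ z (u + t • (d - u)))) (d - u) ≤ 0 := by
    intro t ht ht1
    have hmem : u + t • (d - u) ∈ dualSet N p :=
      (convex_dualSet p).add_smul_sub_mem hu hd ⟨ht.le, ht1⟩
    have h1 : conjEnvelope f (z + μ • dvg u) ≤
      conjEnvelope f (z + μ • dvg (u + t • (d - u))) := hmin hmem
    have h2 := conjEnvelope_add_inner_le hf (z + μ • dvg (u + t • (d - u))) (z + μ • dvg u)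
    rw [inner_smul_dvg_sub hN, show u - (u + t • (d - u)) = -(t • (d - u)) by abel,
      inner_neg_right, real_inner_smul_right, mul_neg, neg_neg, ← mul_assoc] at h2
    refine nonpos_of_mul_nonpos_right ?_ (mul_pos hμ ht)
    change μ * t * inner ℝ (grad (prox f (z + μ • dvg (u + t • (d - u))))) (d - u) ≤ 0
    linarith
  have hc : Continuous (gradLM N) := continuous_gradLM
  have hlim : Tendsto (fun t : ℝ =>
      inner ℝ (gradLM N (primalPoint f μ z (u + t • (d - u)))) (d - u)) (𝓝[>] 0)
      (𝓝 (inner ℝ (gradLM N (primalPoint f μ z u)) (d - u))) := by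
    have hp := continuous_primalPoint (μ := μ) (z := z) hf
    have h : Continuous fun t : ℝ =>
        inner ℝ (gradLM N (primalPoint f μ z (u + t • (d - u)))) (d - u) := by fun_prop
    have h0 := h.tendsto 0
    rw [zero_smul, add_zero] at h0
    exact h0.mono_left nhdsWithin_le_nhds
  refine le_of_tendsto hlim ?_
  filter_upwards [Ioc_mem_nhdsGT (zero_lt_one (α := ℝ))] with t ht
  exact key t ht.1 ht.2

theorem isSolution_dualObj (hN : 2 ≤ N) (hf : IsGammaZero f) (hμ : 0 < μ) {u : Fld N}
    (hu : u ∈ dualVI f μ z p) : IsSolution (dualSet N p) (dualObj f μ z) u := by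
  refine ⟨hu.1, ?_, fun d hd => ?_⟩
  · rw [dualObj_eq hf]
    exact EReal.coe_lt_top _
  · rw [dualObj_eq hf, dualObj_eq hf, EReal.coe_le_coe_iff]
    have h := conjEnvelope_add_inner_le hf (z + μ • dvg u) (z + μ • dvg d)
    rw [inner_smul_dvg_sub hN] at h
    have h2 : μ * inner ℝ (grad (prox f (z + μ • dvg u))) (d - u) ≤ 0 :=
      mul_nonpos_of_nonneg_of_nonpos hμ.le (hu.2 d hd)
    linarith

/-- At a solution `u` of the dual variational inequality, `u` is extremal in the dual formula
for `tv_p`. -/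
theorem tv_primalPoint (hp : 1 ≤ p) {u : Fld N} (hu : u ∈ dualVI f μ z p) :
    tv p (primalPoint f μ z u) = inner ℝ (grad (primalPoint f μ z u)) u := by
  refine le_antisymm ?_ (inner_le_normPOne hp _ hu.1)
  obtain ⟨d, hd, h⟩ := exists_inner_eq_normPOne hp (grad (primalPoint f μ z u))
  have h2 := hu.2 d hd
  rw [inner_sub_right] at h2
  rw [tv, ← h]
  exact sub_nonpos.1 h2

/-- The primal objective grows quadratically around the primal point of a solution of the dual
variational inequality. -/
theorem primalObj_add_le (hN : 2 ≤ N) (hf : IsGammaZero f) (hμ : 0 < μ) (hp : 1 ≤ p)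
    {u : Fld N} (hu : u ∈ dualVI f μ z p) (y : Img N) :
    primalObj f μ p z (primalPoint f μ z u) +
      ((1 / 2 * ‖y - primalPoint f μ z u‖ ^ 2 : ℝ) : EReal) ≤ primalObj f μ p z y := by
  set x := primalPoint f μ z u with hx
  set r := proxValue f (z + μ • dvg u)
  have hfx : f x = r := apply_prox hf _
  have hfy : ((r + inner ℝ (z + μ • dvg u - x) (y - x) : ℝ) : EReal) ≤ f y :=
    proxValue_add_inner_le hf _ y
  have htx : tv p x = - inner ℝ x (dvg u) := (tv_primalPoint hp hu).trans (inner_grad hN _ _)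
  have hty : - inner ℝ y (dvg u) ≤ tv p y :=
    (inner_grad hN y u).symm.trans_le (inner_le_normPOne hp _ hu.1)
  refine le_trans ?_ (add_le_add hfy le_rfl)
  rw [primalObj, hfx, ← EReal.coe_add, ← EReal.coe_add, ← EReal.coe_add, EReal.coe_le_coe_iff]
  have h1 : ‖y - z‖ ^ 2 = ‖y - x‖ ^ 2 + 2 * inner ℝ (y - x) (x - z) + ‖x - z‖ ^ 2 := by
    rw [← norm_add_sq_real, sub_add_sub_cancel]
  have h2 : inner ℝ (z + μ • dvg u - x) (y - x) =
      - inner ℝ (y - x) (x - z) + μ * (inner ℝ y (dvg u) - inner ℝ x (dvg u)) := by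
    rw [real_inner_comm, show z + μ • dvg u - x = μ • dvg u - (x - z) by abel, inner_sub_right,
      real_inner_smul_right, inner_sub_left]
    ring
  have h3 := mul_le_mul_of_nonneg_left hty hμ.le
  rw [h1, h2, htx]
  linarith

theorem isSolution_primalObj (hN : 2 ≤ N) (hf : IsGammaZero f) (hμ : 0 < μ) (hp : 1 ≤ p)
    {u : Fld N} (hu : u ∈ dualVI f μ z p) :
    IsSolution Set.univ (primalObj f μ p z) (primalPoint f μ z u) := by
  refine ⟨Set.mem_univ _, ?_, fun y _ => ?_⟩
  · rw [primalObj, primalPoint, apply_prox hf, ← EReal.coe_add]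
    exact EReal.coe_lt_top _
  · refine le_trans ?_ (primalObj_add_le hN hf hμ hp hu y)
    refine le_add_of_nonneg_right ?_
    exact_mod_cast (by positivity : (0 : ℝ) ≤ 1 / 2 * ‖y - primalPoint f μ z u‖ ^ 2)

theorem eq_primalPoint_of_isSolution (hN : 2 ≤ N) (hf : IsGammaZero f) (hμ : 0 < μ)
    (hp : 1 ≤ p) {u : Fld N} (hu : u ∈ dualVI f μ z p) {y : Img N}
    (hy : IsSolution Set.univ (primalObj f μ p z) y) : y = primalPoint f μ z u := by
  have h := (primalObj_add_le hN hf hμ hp hu y).trans (hy.2.2 (primalPoint f μ z u) trivial)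
  rw [primalObj, primalPoint, apply_prox hf, ← EReal.coe_add, ← EReal.coe_add,
    EReal.coe_le_coe_iff] at h
  have h2 : ‖y - primalPoint f μ z u‖ ^ 2 ≤ 0 := by
    rw [primalPoint]
    linarith
  exact sub_eq_zero.1 (norm_eq_zero.1 (pow_eq_zero_iff two_ne_zero |>.1
    (le_antisymm h2 (by positivity))))

end Duality

end TVDenoising

/-! ### Convergence of the algorithm -/

theorem proposition4p12 (N : ℕ) (hN : 2 ≤ N) (z : Img N) (f : Img N → EReal)
    (hf : IsGammaZero f) (μ : ℝ) (hμ : 0 < μ) (p : ℝ≥0∞) (hp : 1 ≤ p)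
    -- the tolerances
    (α₁ α₂ : ℕ → Img N)
    (hα : Summable fun n : ℕ =>
      Real.sqrt (∑ k : Fin N, ∑ l : Fin N, (|α₁ n (k, l)| ^ 2 + |α₂ n (k, l)| ^ 2)))
    (b : ℕ → Img N) (hb : Summable fun n : ℕ => ‖b n‖)
    -- the parameters of the algorithm
    (ε : ℝ) (hε : ε ∈ Set.Ioo 0 (min 1 (μ⁻¹ / 8)))
    (τ : ℕ → ℝ) (hτ : ∀ n, τ n ∈ Set.Icc ε (μ⁻¹ / 4 - ε))
    (lam : ℕ → ℝ) (hlam : ∀ n, lam n ∈ Set.Icc ε 1)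
    -- the sequences generated by the algorithm, from an arbitrary `v 0`
    (x : ℕ → Img N) (v ζ : ℕ → Fld N)
    (hx : ∀ n, x n = prox f (z + μ • dvg (v n)) + b n)
    (hζ : ∀ n, ζ n = v n + τ n • grad (x n))
    (hv₁ : ∀ n (k l : Fin N), (v (n + 1)).fst (k, l) = (v n).fst (k, l) +
      lam n * (pairProj p ((ζ n).fst (k, l)) ((ζ n).snd (k, l)) 0 + α₁ n (k, l)
        - (v n).fst (k, l)))
    (hv₂ : ∀ n (k l : Fin N), (v (n + 1)).snd (k, l) = (v n).snd (k, l) +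
      lam n * (pairProj p ((ζ n).fst (k, l)) ((ζ n).snd (k, l)) 1 + α₂ n (k, l)
        - (v n).snd (k, l))) :
    ∃ (vsol : Fld N) (xsol : Img N),
      Tendsto v atTop (𝓝 vsol) ∧
      IsSolution (dualSet N p) (dualObj f μ z) vsol ∧
      xsol = prox f (z + μ • dvg vsol) ∧
      IsSolution Set.univ (primalObj f μ p z) xsol ∧
      (∀ y : Img N, IsSolution Set.univ (primalObj f μ p z) y → y = xsol) ∧
      Tendsto x atTop (𝓝 xsol) := by
  obtain ⟨hε0, -⟩ := hε
  set a : ℕ → Fld N := fun n => WithLp.toLp 2 (α₁ n, α₂ n) with ha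
  have hna : Summable fun n => ‖a n‖ := by
    refine hα.congr fun n => ?_
    rw [WithLp.prod_norm_eq_of_L2, EuclideanSpace.norm_sq_eq, EuclideanSpace.norm_sq_eq,
      Fintype.sum_prod_type, Fintype.sum_prod_type, ← Finset.sum_add_distrib]
    simp only [← Finset.sum_add_distrib, ha, Real.norm_eq_abs]
    rfl
  have hstep : ∀ n, v (n + 1) = v n + lam n • (fldProj p (v n + τ n • gradLM N
      (primalPoint f μ z (v n) + b n)) + a n - v n) := by
    intro n
    have hζn : v n + τ n • gradLM N (primalPoint f μ z (v n) + b n) = ζ n := by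
      rw [hζ n, hx n]; rfl
    rw [hζn]
    exact fld_ext (fun kl => hv₁ n kl.1 kl.2) (fun kl => hv₂ n kl.1 kl.2)
  -- the coefficient `2 μ⁻¹ - 8 τ n` of the gain is at least `8 ε`, as `τ n ≤ μ⁻¹ / 4 - ε`
  obtain ⟨u, hu, hlim⟩ := forwardBackward_tendsto (isClosed_dualSet p) (fldProj_mem p)
    (inner_sub_fldProj_le p) (continuous_primalPoint hf) (gradLM N)
    norm_grad_sq_le (inner_grad_primalPoint_sub_le hN hf hμ)
    (dualVI_nonempty hN hf hμ) hε0 (δ := 8 * ε) (T := μ⁻¹ / 4 - ε) (by positivity)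
    (fun n => (hτ n).1) (fun n => (hτ n).2) (fun n => by linarith [(hτ n).2]) hlam hna hb hstep
  refine ⟨u, primalPoint f μ z u, hlim, isSolution_dualObj hN hf hμ hu, rfl,
    isSolution_primalObj hN hf hμ hp hu,
    fun y hy => eq_primalPoint_of_isSolution hN hf hμ hp hu hy, ?_⟩
  have hb0 : Tendsto b atTop (𝓝 0) :=
    tendsto_zero_iff_norm_tendsto_zero.2 hb.tendsto_atTop_zero
  have h1 := (((continuous_primalPoint (μ := μ) (z := z) hf).tendsto u).comp hlim).add hb0
  rw [add_zero] at h1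
  exact h1.congr fun n => (hx n).symm
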